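/- Let $L_{PA}=\{0,1,+,\cdot,<\}$ be the language of arithmetic, let $\mathrm{PA}$ be the $L_{PA}$-theory consisting of the axioms of discretely ordered semirings and the induction scheme, and let $\mathrm{Th}(\mathbb N)$ be the set of all first-order $L_{PA}$-sentences true in the standard model $\mathbb N$. For ordinals $\alpha$ define the classes of $\Sigma^{\mathrm{in}}_\alpha$ and $\Pi^{\mathrm{in}}_\alpha$ formulas of $L_{\omega_1\omega}$ as usual: for $\alpha=0$ both are the finitary quantifier-free formulas; for $\alpha>0$ a $\Sigma^{\mathrm{in}}_\alpha$ formula is a countable disjunction $\bigvee_i\exists\bar y_i\,\varphi_i(\bar x,\bar y_i)$ and a $\Pi^{\mathrm{in}}_\alpha$ formula is a countable conjunction $\bigwedge_i\forall\bar y_i\,\varphi_i(\bar x,\bar y_i)$, where in the former case each $\varphi_i$ is $\Pi^{\mathrm{in}}_{\beta_i}$, and in the latter $\Sigma^{\mathrm{in}}_{\beta_i}$, for some $\beta_i<\alpha$. The (parameterless) Scott rank $SR(\mathcal A)$ of a countable structure $\mathcal A$ is the least ordinal $\alpha\ge 1$ such that for every finite tuple $\bar a$ of $\mathcal A$ the orbit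 of $\bar a$ under the automorphism group of $\mathcal A$ is definable in $\mathcal A$ by a $\Sigma^{\mathrm{in}}_\alpha$ formula without parameters. **Theorem.** Let $\mathcal M$ be a countable model of $\mathrm{PA}$ such that $\mathcal M\not\models \mathrm{Th}(\mathbb N)$. Then $SR(\mathcal M)\ge\omega$; that is, $\mathcal M$ has no finite Scott rank. -/

import Mathlib

open FirstOrder

universe u v w

/-! ### Peano arithmetic -/

/-- Function symbols `0, 1, +, ·` of the language of arithmetic. -/
inductive ArithFunc : ℕ → Type
  | zero : ArithFunc 0
  | one : ArithFunc 0
  | add : ArithFunc 2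
  | mul : ArithFunc 2

/-- The relation symbol `<` of the language of arithmetic. -/
inductive ArithRel : ℕ → Type
  | lt : ArithRel 2

/-- The language `{0, 1, +, ·, <}` of arithmetic (of ordered semirings). -/
abbrev arith : FirstOrder.Language.{0, 0} where
  Functions := ArithFunc
  Relations := ArithRel

namespace arith

instance {α : Type u} : Zero (arith.Term α) where
  zero := FirstOrder.Language.Constants.term (L := arith) ArithFunc.zero

instance {α : Type u} : One (arith.Term α) where
  one := FirstOrder.Language.Constants.term (L := arith) ArithFunc.one

instance {α : Type u} : Add (arith.Term α) where
  add := FirstOrder.Language.Functions.apply₂ (L := arith) ArithFunc.add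

instance {α : Type u} : Mul (arith.Term α) where
  mul := FirstOrder.Language.Functions.apply₂ (L := arith) ArithFunc.mul

/-- The atomic formula `s < t`. -/
def lt {α : Type u} {n : ℕ} (s t : arith.Term (α ⊕ Fin n)) : arith.BoundedFormula α n :=
  FirstOrder.Language.Relations.boundedFormula₂ (L := arith) ArithRel.lt s t

/-- The standard model `ℕ` of arithmetic. -/
instance : arith.Structure ℕ where
  funMap := fun {_} f => match f with
    | ArithFunc.zero => fun _ => 0
    | ArithFunc.one => fun _ => 1
    | ArithFunc.add => fun x => x 0 + x 1
    | ArithFunc.mul => fun x => x 0 * x 1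
  RelMap := fun {_} r => match r with
    | ArithRel.lt => fun x => x 0 < x 1

/-- The axioms of (the nonnegative parts of) discretely ordered rings. -/
inductive DiscreteOrderedSemiringAxiom : arith.Sentence → Prop
  | add_assoc : DiscreteOrderedSemiringAxiom
      (∀' ∀' ∀' (((&0 + &1) + &2) =' (&0 + (&1 + &2))))
  | add_comm : DiscreteOrderedSemiringAxiom (∀' ∀' ((&0 + &1) =' (&1 + &0)))
  | mul_assoc : DiscreteOrderedSemiringAxiom
      (∀' ∀' ∀' (((&0 * &1) * &2) =' (&0 * (&1 * &2))))
  | mul_comm : DiscreteOrderedSemiringAxiom (∀' ∀' ((&0 * &1) =' (&1 * &0)))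
  | mul_add : DiscreteOrderedSemiringAxiom
      (∀' ∀' ∀' ((&0 * (&1 + &2)) =' ((&0 * &1) + (&0 * &2))))
  | add_zero : DiscreteOrderedSemiringAxiom (∀' ((&0 + 0) =' &0))
  | mul_zero : DiscreteOrderedSemiringAxiom (∀' ((&0 * 0) =' 0))
  | mul_one : DiscreteOrderedSemiringAxiom (∀' ((&0 * 1) =' &0))
  | lt_trans : DiscreteOrderedSemiringAxiom
      (∀' ∀' ∀' (lt (&0) (&1) ⟹ lt (&1) (&2) ⟹ lt (&0) (&2)))
  | lt_irrefl : DiscreteOrderedSemiringAxiom (∀' ∼(lt (&0) (&0)))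
  | lt_total : DiscreteOrderedSemiringAxiom
      (∀' ∀' (lt (&0) (&1) ⊔ ((&0) =' (&1)) ⊔ lt (&1) (&0)))
  | add_lt_add : DiscreteOrderedSemiringAxiom
      (∀' ∀' ∀' (lt (&0) (&1) ⟹ lt (&0 + &2) (&1 + &2)))
  | mul_lt_mul : DiscreteOrderedSemiringAxiom
      (∀' ∀' ∀' (lt 0 (&2) ⟹ lt (&0) (&1) ⟹ lt (&0 * &2) (&1 * &2)))
  | exists_add : DiscreteOrderedSemiringAxiom
      (∀' ∀' (lt (&0) (&1) ⟹ ∃' ((&0 + &2) =' &1)))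
  | zero_lt_one : DiscreteOrderedSemiringAxiom (lt 0 1)
  | discrete : DiscreteOrderedSemiringAxiom
      (∀' (lt 0 (&0) ⟹ (((1 : arith.Term (Empty ⊕ Fin 1)) =' &0) ⊔ lt 1 (&0))))
  | nonneg : DiscreteOrderedSemiringAxiom
      (∀' (((0 : arith.Term (Empty ⊕ Fin 1)) =' &0) ⊔ lt 0 (&0)))

/-- The induction axiom for the formula `φ(p, x)` with parameters `p = (p₁, …, pₙ)`:
`∀ p, φ(p, 0) → (∀ x, φ(p, x) → φ(p, x + 1)) → ∀ x, φ(p, x)`. -/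
noncomputable def inductionAxiom {n : ℕ} (φ : arith.Formula (Fin n ⊕ Fin 1)) : arith.Sentence :=
  let base : arith.Formula (Fin n) := φ.subst (Sum.elim FirstOrder.Language.Term.var fun _ => 0)
  let next : arith.Formula (Fin n ⊕ Fin 1) :=
    φ.subst (Sum.elim (fun i => FirstOrder.Language.Term.var (Sum.inl i))
      fun i => FirstOrder.Language.Term.var (Sum.inr i) + 1)
  let body : arith.Formula (Fin n) :=
    base ⟹ FirstOrder.Language.Formula.iAlls (Fin 1) (φ ⟹ next) ⟹
      FirstOrder.Language.Formula.iAlls (Fin 1) φ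
  FirstOrder.Language.Formula.iAlls (Fin n)
    (FirstOrder.Language.Formula.relabel (Sum.inr : Fin n → Empty ⊕ Fin n) body)

/-- Peano arithmetic: the axioms of discretely ordered semirings and the induction scheme. -/
def PA : arith.Theory :=
  {σ | DiscreteOrderedSemiringAxiom σ} ∪ {σ | ∃ (n : ℕ) (φ : arith.Formula (Fin n ⊕ Fin 1)),
    σ = inductionAxiom φ}

end arith

/-! ### Infinitary formulas and Scott rank -/

/-- Formulas of `L_{ω₁ω}` in normal form, with free variables `x₀, …, xₙ₋₁`. They are built from
finitary formulas by `⋁_{i ∈ ℕ} ∃ ȳᵢ φᵢ(x̄, ȳᵢ)` and `⋀_{i ∈ ℕ} ∀ ȳᵢ φᵢ(x̄, ȳᵢ)`, where `ȳᵢ` is a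
finite tuple, possibly empty, of length `k i`. (Only quantifier-free finitary formulas are used in
the classes `IsSigma` and `IsPi` below. Finite disjunctions are obtained by repetition.) -/
inductive InfFormula (L : FirstOrder.Language.{u, v}) : ℕ → Type (max u v)
  | ofFormula {n : ℕ} (φ : L.Formula (Fin n)) : InfFormula L n
  | iSupEx {n : ℕ} (k : ℕ → ℕ) (φ : ∀ i, InfFormula L (n + k i)) : InfFormula L n
  | iInfAll {n : ℕ} (k : ℕ → ℕ) (φ : ∀ i, InfFormula L (n + k i)) : InfFormula L n

namespace InfFormula

variable {L : FirstOrder.Language.{u, v}}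

/-- Satisfaction of an infinitary formula by a tuple of a structure. -/
def Realize {M : Type w} [L.Structure M] : {n : ℕ} → InfFormula L n → (Fin n → M) → Prop
  | _, ofFormula φ, x => FirstOrder.Language.Formula.Realize φ x
  | _, iSupEx k φ, x => ∃ i, ∃ y : Fin (k i) → M, (φ i).Realize (Fin.append x y)
  | _, iInfAll k φ, x => ∀ i, ∀ y : Fin (k i) → M, (φ i).Realize (Fin.append x y)

mutual

/-- `Σ_α` formulas of `L_{ω₁ω}`: the `Σ₀` formulas are the finitary quantifier-free formulas, and for
`α > 0` the `Σ_α` formulas are the countable disjunctions `⋁ᵢ ∃ ȳᵢ φᵢ` where each `φᵢ` is `Π_β` for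
some `β < α`. -/
inductive IsSigma : Ordinal.{0} → {n : ℕ} → InfFormula L n → Prop
  | quantifierFree {n : ℕ} {φ : L.Formula (Fin n)} (h : FirstOrder.Language.BoundedFormula.IsQF φ) :
      IsSigma 0 (ofFormula φ)
  | iSupEx {n : ℕ} {α : Ordinal.{0}} {k : ℕ → ℕ} {φ : ∀ i, InfFormula L (n + k i)}
      (β : ℕ → Ordinal.{0}) (hβ : ∀ i, β i < α) (h : ∀ i, IsPi (β i) (φ i)) :
      IsSigma α (iSupEx k φ)

/-- `Π_α` formulas of `L_{ω₁ω}`: the `Π₀` formulas are the finitary quantifier-free formulas, and for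
`α > 0` the `Π_α` formulas are the countable conjunctions `⋀ᵢ ∀ ȳᵢ φᵢ` where each `φᵢ` is `Σ_β` for
some `β < α`. -/
inductive IsPi : Ordinal.{0} → {n : ℕ} → InfFormula L n → Prop
  | quantifierFree {n : ℕ} {φ : L.Formula (Fin n)} (h : FirstOrder.Language.BoundedFormula.IsQF φ) :
      IsPi 0 (ofFormula φ)
  | iInfAll {n : ℕ} {α : Ordinal.{0}} {k : ℕ → ℕ} {φ : ∀ i, InfFormula L (n + k i)}
      (β : ℕ → Ordinal.{0}) (hβ : ∀ i, β i < α) (h : ∀ i, IsSigma (β i) (φ i)) :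
      IsPi α (iInfAll k φ)

end

end InfFormula

/-- Every automorphism orbit of finite tuples of `M` is definable, without parameters, by a `Σ_α`
formula of `L_{ω₁ω}`. -/
def OrbitsSigmaDefinable (L : FirstOrder.Language.{u, v}) (M : Type w) [L.Structure M]
    (α : Ordinal.{0}) : Prop :=
  ∀ (n : ℕ) (a : Fin n → M), ∃ φ : InfFormula L n, φ.IsSigma α ∧
    ∀ b : Fin n → M, φ.Realize b ↔ ∃ σ : M ≃[L] M, ∀ i, σ (a i) = b i

/-- The (parameterless) Scott rank of a countable structure `M`: the least ordinal `α ≥ 1` such that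
all automorphism orbits of `M` are `Σ_α`-definable without parameters. (The different
characterizations of Scott rank agree only for `α ≥ 1`; with this convention the standard model of
arithmetic has Scott rank `1`.) The value `⊤` says that there is no such ordinal; it is not attained
by countable structures in a countable language. -/
noncomputable def scottRank (L : FirstOrder.Language.{u, v}) (M : Type w) [L.Structure M] :
    WithTop Ordinal.{0} :=
  sInf {r | ∃ α : Ordinal.{0}, r = α ∧ 1 ≤ α ∧ OrbitsSigmaDefinable L M α}

-- If `x` is fixed by every automorphism, its orbit is `{x}`, so this orbit is not Σₙ-definable once
-- some `y ≠ x` satisfies every Σₙ formula true of `x`. Overspill produces such a pair for every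
-- finite `n`.
--
-- Elements of `M` code tuples by a definable pairing function. Gödel's beta function gives a
-- formula `ValueLt i j x` which, for standard `i` and `j`, compares the `i`-th and `j`-th terms
-- with projections at `x`; these comparisons determine the quantifier-free type of the coded tuple.
-- So for each `n` the relation `BackForth n c x y` (`n` rounds of back-and-forth ending in
-- agreement on the terms below `c`) is definable, with `c` a variable over `M`.
--
-- For standard `c`, finitely many types suffice to decide relatedness
-- (`exists_finite_classification`), so distinct related elements exist. For `c` above all standard
-- numbers, related elements satisfy the same Σₙ formulas (`BackForth.realize_infFormula`). Some
-- nonstandard element is fixed by all automorphisms, since otherwise the Tarski–Vaught test,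
-- applied to least witnesses, would give `ℕ ≺ M` (`realize_completeTheory_of_fixed`). Overspill
-- below it yields a fixed nonstandard `c` with distinct related elements, and the least first
-- member `x` of such a pair is fixed too (`exists_fixed_ne_backForth`).

/-! ### Models of arithmetic as ordered semirings -/

open FirstOrder.Language in
/-- The arithmetic structure on `M` is the one given by an ordered semiring structure, and it
satisfies the induction scheme. -/
class ArithModel (M : Type u) [CommSemiring M] [LinearOrder M] [arith.Structure M] : Prop
    extends IsStrictOrderedRing M where
  funMap_zero : ∀ x : Fin 0 → M, Structure.funMap (L := arith) ArithFunc.zero x = 0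
  funMap_one : ∀ x : Fin 0 → M, Structure.funMap (L := arith) ArithFunc.one x = 1
  funMap_add : ∀ x : Fin 2 → M, Structure.funMap (L := arith) ArithFunc.add x = x 0 + x 1
  funMap_mul : ∀ x : Fin 2 → M, Structure.funMap (L := arith) ArithFunc.mul x = x 0 * x 1
  relMap_lt : ∀ x : Fin 2 → M, Structure.RelMap (L := arith) ArithRel.lt x ↔ x 0 < x 1
  zero_le' : ∀ x : M, 0 ≤ x
  exists_add' : ∀ x y : M, x < y → ∃ z, x + z = y
  one_le' : ∀ x : M, 0 < x → 1 ≤ x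
  induct : ∀ (n : ℕ) (φ : arith.Formula (Fin n ⊕ Fin 1)) (p : Fin n → M),
    φ.Realize (Sum.elim p fun _ => 0) →
    (∀ x, φ.Realize (Sum.elim p fun _ => x) → φ.Realize (Sum.elim p fun _ => x + 1)) →
    ∀ x, φ.Realize (Sum.elim p fun _ => x)

namespace arith

open FirstOrder.Language

section Realize

variable {M : Type u} [arith.Structure M] {α : Type v}

theorem realize_zero (v : α → M) :
    (0 : arith.Term α).realize v = Structure.funMap (L := arith) ArithFunc.zero (Fin.elim0) := by
  change Structure.funMap _ _ = _
  congr 1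
  exact Subsingleton.elim _ _

theorem realize_one (v : α → M) :
    (1 : arith.Term α).realize v = Structure.funMap (L := arith) ArithFunc.one (Fin.elim0) := by
  change Structure.funMap _ _ = _
  congr 1
  exact Subsingleton.elim _ _

theorem realize_add (s t : arith.Term α) (v : α → M) :
    (s + t).realize v =
      Structure.funMap (L := arith) ArithFunc.add ![s.realize v, t.realize v] :=
  Term.realize_functions_apply₂

theorem realize_mul (s t : arith.Term α) (v : α → M) :
    (s * t).realize v =
      Structure.funMap (L := arith) ArithFunc.mul ![s.realize v, t.realize v] :=
  Term.realize_functions_apply₂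

theorem realize_lt {n : ℕ} (s t : arith.Term (α ⊕ Fin n)) (v : α → M) (x : Fin n → M) :
    (lt s t).Realize v x ↔ Structure.RelMap (L := arith) ArithRel.lt
      ![s.realize (Sum.elim v x), t.realize (Sum.elim v x)] :=
  BoundedFormula.realize_rel₂

end Realize

/-- Passing to algebraic classes makes `ring`, `positivity` and the order lemmas available in place
of first-order axioms. -/
theorem exists_arithModel {M : Type u} [arith.Structure M] (h : M ⊨ PA) :
    ∃ (_ : CommSemiring M) (_ : LinearOrder M), ArithModel M := by
  classical
  have ax : ∀ σ, DiscreteOrderedSemiringAxiom σ → M ⊨ σ := fun σ hσ =>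
    Theory.realize_sentence_of_mem PA (Or.inl hσ)
  have ind : ∀ (n : ℕ) (φ : arith.Formula (Fin n ⊕ Fin 1)), M ⊨ inductionAxiom φ := fun n φ =>
    Theory.realize_sentence_of_mem PA (Or.inr ⟨n, φ, rfl⟩)
  let z : M := Structure.funMap (L := arith) ArithFunc.zero Fin.elim0
  let o : M := Structure.funMap (L := arith) ArithFunc.one Fin.elim0
  let a : M → M → M := fun x y => Structure.funMap (L := arith) ArithFunc.add ![x, y]
  let m : M → M → M := fun x y => Structure.funMap (L := arith) ArithFunc.mul ![x, y]
  let l : M → M → Prop := fun x y => Structure.RelMap (L := arith) ArithRel.lt ![x, y]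
  have e1 := ax _ .add_assoc
  have e2 := ax _ .add_comm
  have e3 := ax _ .mul_assoc
  have e4 := ax _ .mul_comm
  have e5 := ax _ .mul_add
  have e6 := ax _ .add_zero
  have e7 := ax _ .mul_zero
  have e8 := ax _ .mul_one
  have e9 := ax _ .lt_trans
  have e10 := ax _ .lt_irrefl
  have e11 := ax _ .lt_total
  have e12 := ax _ .add_lt_add
  have e13 := ax _ .mul_lt_mul
  have e14 := ax _ .exists_add
  have e15 := ax _ .zero_lt_one
  have e16 := ax _ .discrete
  have e17 := ax _ .nonneg
  simp only [Sentence.Realize, Formula.Realize, BoundedFormula.realize_all,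
    BoundedFormula.realize_bdEqual, BoundedFormula.realize_imp, BoundedFormula.realize_not,
    BoundedFormula.realize_sup, BoundedFormula.realize_ex, realize_lt, realize_add, realize_mul,
    realize_zero, realize_one, Term.realize_var, Sum.elim_inr, Function.comp_apply]
    at e1 e2 e3 e4 e5 e6 e7 e8 e9 e10 e11 e12 e13 e14 e15 e16 e17
  have f1 : ∀ x y z, a (a x y) z = a x (a y z) := e1
  have f2 : ∀ x y, a x y = a y x := e2
  have f3 : ∀ x y z, m (m x y) z = m x (m y z) := e3
  have f4 : ∀ x y, m x y = m y x := e4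
  have f5 : ∀ x y w, m x (a y w) = a (m x y) (m x w) := e5
  have f6 : ∀ x, a x z = x := e6
  have f7 : ∀ x, m x z = z := e7
  have f8 : ∀ x, m x o = x := e8
  have f9 : ∀ x y w, l x y → l y w → l x w := e9
  have f10 : ∀ x, ¬ l x x := e10
  have f11 : ∀ x y, (l x y ∨ x = y) ∨ l y x := e11
  have f12 : ∀ x y w, l x y → l (a x w) (a y w) := e12
  have f13 : ∀ x y w, l z w → l x y → l (m x w) (m y w) := e13
  have f14 : ∀ x y, l x y → ∃ w, a x w = y := e14
  have f15 : l z o := e15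
  have f16 : ∀ x, l z x → o = x ∨ l o x := e16
  have f17 : ∀ x, z = x ∨ l z x := e17
  clear e1 e2 e3 e4 e5 e6 e7 e8 e9 e10 e11 e12 e13 e14 e15 e16 e17
  let iS : CommSemiring M :=
    { add := a
      zero := z
      mul := m
      one := o
      add_assoc := f1
      add_comm := f2
      mul_assoc := f3
      mul_comm := f4
      add_zero := f6
      zero_add := fun x => (f2 z x).trans (f6 x)
      mul_zero := f7
      zero_mul := fun x => (f4 z x).trans (f7 x)
      mul_one := f8
      one_mul := fun x => (f4 o x).trans (f8 x)
      left_distrib := f5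
      right_distrib := fun x y w => by
        change m (a x y) w = a (m x w) (m y w)
        rw [f4, f5, f4 w x, f4 w y]
      nsmul := @nsmulRec M ⟨z⟩ ⟨a⟩
      npow := @npowRec M ⟨o⟩ ⟨m⟩ }
  let iO : LinearOrder M :=
    { le := fun x y => l x y ∨ x = y
      lt := l
      le_refl := fun x => Or.inr rfl
      le_trans := by
        rintro x y w (h1 | rfl) (h2 | rfl)
        · exact Or.inl (f9 _ _ _ h1 h2)
        · exact Or.inl h1
        · exact Or.inl h2
        · exact Or.inr rfl
      le_antisymm := by
        rintro x y (h1 | rfl) (h2 | h2)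
        · exact absurd (f9 _ _ _ h1 h2) (f10 _)
        · exact h2.symm
        · rfl
        · rfl
      le_total := fun x y => by
        rcases f11 x y with (h | h) | h
        · exact Or.inl (Or.inl h)
        · exact Or.inl (Or.inr h)
        · exact Or.inr (Or.inl h)
      lt_iff_le_not_ge := fun x y => by
        constructor
        · rintro h
          refine ⟨Or.inl h, ?_⟩
          rintro (h' | rfl)
          · exact f10 _ (f9 _ _ _ h h')
          · exact f10 _ h
        · rintro ⟨h | rfl, h'⟩
          · exact h
          · exact absurd (Or.inr rfl) h'
      toDecidableLE := Classical.decRel _ }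
  have hadd : ∀ x y w : M, x < y → x + w < y + w := f12
  have hmul : ∀ x y w : M, 0 < w → x < y → x * w < y * w := f13
  have hcov : ∀ x y w : M, x ≤ y → x + w ≤ y + w := by
    intro x y w h
    rcases h.lt_or_eq with h | rfl
    · exact (hadd _ _ _ h).le
    · exact le_rfl
  have iR : IsStrictOrderedRing M :=
    { add_le_add_left := fun x y h w => by simpa only [add_comm] using hcov x y w h
      le_of_add_le_add_left := fun w x y h => by
        by_contra h'
        have := hadd _ _ w (not_le.1 h')
        rw [add_comm y, add_comm x] at this
        exact absurd h (not_le.2 this)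
      zero_le_one := Or.inl f15
      exists_pair_ne := ⟨z, o, fun e => f10 z (by rw [e] at f15; rw [e]; exact f15)⟩
      mul_lt_mul_of_pos_left := fun w hw x y h => by
        simpa only [mul_comm] using hmul x y w hw h
      mul_lt_mul_of_pos_right := fun w hw x y h => hmul x y w hw h }
  have vec : ∀ x : Fin 2 → M, x = ![x 0, x 1] := fun x => by
    ext i; fin_cases i <;> rfl
  refine ⟨iS, iO, @ArithModel.mk M iS iO _ iR ?_ ?_ ?_ ?_ ?_ ?_ ?_ ?_ ?_⟩
  · intro x
    rw [Subsingleton.elim x Fin.elim0]; rfl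
  · intro x
    rw [Subsingleton.elim x Fin.elim0]; rfl
  · intro x
    conv_lhs => rw [vec x]
    rfl
  · intro x
    conv_lhs => rw [vec x]
    rfl
  · intro x
    conv_lhs => rw [vec x]
    exact Iff.rfl
  · intro x
    exact (f17 x).elim (fun h => Or.inr h) (fun h => Or.inl h)
  · exact f14
  · intro x hx
    exact (f16 x hx).elim (fun h => Or.inr h) (fun h => Or.inl h)
  · intro n φ p h0 h1 x
    have key := ind n φ
    simp only [inductionAxiom, Sentence.Realize, Formula.realize_iAlls, Formula.realize_relabel,
      Formula.realize_imp] at key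
    have key := key p
    have hp : (fun a => Sum.elim (default : Empty → M) p a) ∘ Sum.inr = p := rfl
    simp only [hp] at key
    have := key ?_ ?_ fun _ => x
    · exact this
    · refine BoundedFormula.realize_subst.2 ?_
      refine (congrArg (fun v => BoundedFormula.Realize φ v default) ?_).mpr h0
      ext (i | i)
      · rfl
      · exact realize_zero p
    · intro i hi
      refine BoundedFormula.realize_subst.2 ?_
      have hi' : i = fun _ => i 0 := by ext j; rw [Subsingleton.elim j 0]
      have := h1 (i 0) (by rw [← hi']; exact hi)
      refine (congrArg (fun v => BoundedFormula.Realize φ v default) ?_).mpr this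
      ext (j | j)
      · rfl
      · refine (realize_add _ _ _).trans ?_
        rw [realize_one, Subsingleton.elim j 0]
        rfl

/-! ### Definability without parameters -/

section Definability

variable {M : Type u} [arith.Structure M] {α β : Type}

/-- `f` is the function defined by a term of arithmetic. -/
def DefTerm (f : (α → M) → M) : Prop :=
  ∃ t : arith.Term α, ∀ v, t.realize v = f v

/-- `P` is defined by a formula of arithmetic without parameters. -/
def DefRel (P : (α → M) → Prop) : Prop :=
  ∃ φ : arith.Formula α, ∀ v, φ.Realize v ↔ P v

theorem DefTerm.var (a : α) : DefTerm fun v : α → M => v a :=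
  ⟨Term.var a, fun _ => rfl⟩

theorem DefRel.of_iff {P Q : (α → M) → Prop} (h : DefRel P) (e : ∀ v, Q v ↔ P v) : DefRel Q := by
  obtain ⟨φ, hφ⟩ := h
  exact ⟨φ, fun v => (hφ v).trans (e v).symm⟩

theorem DefRel.eq {f g : (α → M) → M} (hf : DefTerm f) (hg : DefTerm g) :
    DefRel fun v => f v = g v := by
  obtain ⟨s, hs⟩ := hf
  obtain ⟨t, ht⟩ := hg
  exact ⟨s.equal t, fun v => by rw [Formula.realize_equal, hs, ht]⟩

theorem DefRel.not {P : (α → M) → Prop} (h : DefRel P) : DefRel fun v => ¬ P v := by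
  obtain ⟨φ, hφ⟩ := h
  exact ⟨φ.not, fun v => by rw [Formula.realize_not, hφ]⟩

theorem DefRel.imp {P Q : (α → M) → Prop} (h : DefRel P) (h' : DefRel Q) :
    DefRel fun v => P v → Q v := by
  obtain ⟨φ, hφ⟩ := h
  obtain ⟨ψ, hψ⟩ := h'
  exact ⟨φ.imp ψ, fun v => by rw [Formula.realize_imp, hφ, hψ]⟩

theorem DefRel.and {P Q : (α → M) → Prop} (h : DefRel P) (h' : DefRel Q) :
    DefRel fun v => P v ∧ Q v :=
  (h.imp h'.not).not.of_iff fun _ => by tauto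

theorem DefRel.or {P Q : (α → M) → Prop} (h : DefRel P) (h' : DefRel Q) :
    DefRel fun v => P v ∨ Q v :=
  (h.not.imp h').of_iff fun _ => by tauto

theorem DefRel.iff {P Q : (α → M) → Prop} (h : DefRel P) (h' : DefRel Q) :
    DefRel fun v => (P v ↔ Q v) :=
  ((h.imp h').and (h'.imp h)).of_iff fun _ => by tauto

/-- Quantification adds one variable, `Sum.inr 0`. With closure rules of this kind, a definability
proof mirrors the shape of the predicate and no formula is written out. -/
theorem DefRel.all {P : (α → M) → M → Prop}
    (h : DefRel fun w : α ⊕ Fin 1 → M => P (fun a => w (Sum.inl a)) (w (Sum.inr 0))) :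
    DefRel fun v => ∀ u, P v u := by
  obtain ⟨φ, hφ⟩ := h
  refine ⟨φ.iAlls (Fin 1), fun v => ?_⟩
  rw [Formula.realize_iAlls]
  constructor
  · intro h u
    exact (hφ _).1 (h fun _ => u)
  · intro h i
    exact (hφ _).2 (h (i 0))

theorem DefRel.ex {P : (α → M) → M → Prop}
    (h : DefRel fun w : α ⊕ Fin 1 → M => P (fun a => w (Sum.inl a)) (w (Sum.inr 0))) :
    DefRel fun v => ∃ u, P v u :=
  (DefRel.all (P := fun v u => ¬ P v u) h.not).not.of_iff fun _ => by simp

theorem DefRel.subst {P : (β → M) → Prop} (h : DefRel P) {g : β → (α → M) → M}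
    (hg : ∀ b, DefTerm (g b)) : DefRel fun v => P fun b => g b v := by
  obtain ⟨φ, hφ⟩ := h
  choose t ht using hg
  refine ⟨φ.subst t, fun v => ?_⟩
  beta_reduce
  rw [← hφ]
  refine BoundedFormula.realize_subst.trans (iff_of_eq ?_)
  exact congrArg (fun v => BoundedFormula.Realize φ v default) (funext fun b => ht b v)

theorem DefRel.comp₁ {P : M → Prop} (h : DefRel fun v : Fin 1 → M => P (v 0))
    {f : (α → M) → M} (hf : DefTerm f) : DefRel fun v => P (f v) :=
  h.subst (g := fun _ => f) fun _ => hf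

theorem DefRel.comp₂ {P : M → M → Prop} (h : DefRel fun v : Fin 2 → M => P (v 0) (v 1))
    {f₀ f₁ : (α → M) → M} (h₀ : DefTerm f₀) (h₁ : DefTerm f₁) :
    DefRel fun v => P (f₀ v) (f₁ v) :=
  h.subst (g := ![f₀, f₁]) fun b => by fin_cases b <;> assumption

theorem DefRel.comp₃ {P : M → M → M → Prop}
    (h : DefRel fun v : Fin 3 → M => P (v 0) (v 1) (v 2))
    {f₀ f₁ f₂ : (α → M) → M} (h₀ : DefTerm f₀) (h₁ : DefTerm f₁) (h₂ : DefTerm f₂) :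
    DefRel fun v => P (f₀ v) (f₁ v) (f₂ v) :=
  h.subst (g := ![f₀, f₁, f₂]) fun b => by fin_cases b <;> assumption

theorem DefRel.comp₄ {P : M → M → M → M → Prop}
    (h : DefRel fun v : Fin 4 → M => P (v 0) (v 1) (v 2) (v 3))
    {f₀ f₁ f₂ f₃ : (α → M) → M} (h₀ : DefTerm f₀) (h₁ : DefTerm f₁) (h₂ : DefTerm f₂)
    (h₃ : DefTerm f₃) : DefRel fun v => P (f₀ v) (f₁ v) (f₂ v) (f₃ v) :=
  h.subst (g := ![f₀, f₁, f₂, f₃]) fun b => by fin_cases b <;> assumption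

theorem DefRel.map_equiv {P : (α → M) → Prop} (h : DefRel P) (σ : M ≃[arith] M) (v : α → M) :
    P (fun a => σ (v a)) ↔ P v := by
  obtain ⟨φ, hφ⟩ := h
  rw [← hφ, ← hφ]
  exact StrongHomClass.realize_formula σ φ

end Definability

-- Induction and the least number principle for definable relations

section Induction

variable {M : Type u} [CommSemiring M] [LinearOrder M] [arith.Structure M] [ArithModel M]
  {α : Type}

theorem DefTerm.zero : DefTerm fun _ : α → M => 0 :=
  ⟨0, fun v => (realize_zero v).trans (ArithModel.funMap_zero _)⟩

theorem DefTerm.one : DefTerm fun _ : α → M => 1 :=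
  ⟨1, fun v => (realize_one v).trans (ArithModel.funMap_one _)⟩

theorem DefTerm.add {f g : (α → M) → M} (hf : DefTerm f) (hg : DefTerm g) :
    DefTerm fun v => f v + g v := by
  obtain ⟨s, hs⟩ := hf
  obtain ⟨t, ht⟩ := hg
  refine ⟨s + t, fun v => (realize_add s t v).trans ?_⟩
  rw [ArithModel.funMap_add]
  exact congrArg₂ (· + ·) (hs v) (ht v)

theorem DefTerm.mul {f g : (α → M) → M} (hf : DefTerm f) (hg : DefTerm g) :
    DefTerm fun v => f v * g v := by
  obtain ⟨s, hs⟩ := hf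
  obtain ⟨t, ht⟩ := hg
  refine ⟨s * t, fun v => (realize_mul s t v).trans ?_⟩
  rw [ArithModel.funMap_mul]
  exact congrArg₂ (· * ·) (hs v) (ht v)

theorem DefTerm.natCast (n : ℕ) : DefTerm fun _ : α → M => (n : M) := by
  induction n with
  | zero => simpa using DefTerm.zero
  | succ n ih => simpa using ih.add DefTerm.one

theorem DefRel.lt {f g : (α → M) → M} (hf : DefTerm f) (hg : DefTerm g) :
    DefRel fun v => f v < g v := by
  obtain ⟨s, hs⟩ := hf
  obtain ⟨t, ht⟩ := hg
  refine ⟨(Relations.formula₂ (L := arith) ArithRel.lt s t : arith.Formula α), fun v => ?_⟩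
  refine Formula.realize_rel₂.trans ((ArithModel.relMap_lt _).trans ?_)
  beta_reduce
  rw [← hs, ← ht]
  rfl

theorem DefRel.le {f g : (α → M) → M} (hf : DefTerm f) (hg : DefTerm g) :
    DefRel fun v => f v ≤ g v :=
  (DefRel.lt hg hf).not.of_iff fun _ => not_lt.symm

theorem DefRel.induction [Finite α] {P : (α → M) → M → Prop}
    (h : DefRel fun w : α ⊕ Fin 1 → M => P (fun a => w (Sum.inl a)) (w (Sum.inr 0)))
    (v : α → M) (h₀ : P v 0) (h₁ : ∀ x, P v x → P v (x + 1)) (x : M) : P v x := by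
  obtain ⟨φ, hφ⟩ := h
  obtain ⟨n, ⟨e⟩⟩ := Finite.exists_equiv_fin α
  have key : ∀ y : M, ((φ.relabel (Sum.map e id) : arith.Formula (Fin n ⊕ Fin 1)).Realize
      (Sum.elim (v ∘ e.symm) fun _ => y)) ↔ P v y := fun y => by
    rw [Formula.realize_relabel, hφ]
    simp
  have := ArithModel.induct n (φ.relabel (Sum.map e id)) (v ∘ e.symm)
  simp only [key] at this
  exact this h₀ h₁ x

theorem lt_succ_iff_le {x y : M} : x < y + 1 ↔ x ≤ y := by
  constructor
  · intro h
    by_contra! h'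
    obtain ⟨z, rfl⟩ := ArithModel.exists_add' y x h'
    have hz : 0 < z := by
      rcases (ArithModel.zero_le' z).eq_or_lt with h0 | h0
      · rw [← h0, add_zero] at h'; exact absurd h' (lt_irrefl _)
      · exact h0
    exact absurd (lt_of_add_lt_add_left h) (not_lt.2 (ArithModel.one_le' z hz))
  · intro h
    exact h.trans_lt (lt_add_one y)

theorem DefRel.exists_least [Finite α] {P : (α → M) → M → Prop}
    (h : DefRel fun w : α ⊕ Fin 1 → M => P (fun a => w (Sum.inl a)) (w (Sum.inr 0)))
    (v : α → M) {x : M} (hx : P v x) : ∃ m, P v m ∧ ∀ y < m, ¬ P v y := by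
  by_contra! hc
  -- Strong induction: ordinary induction is applied to the statement that `P` fails everywhere
  -- below the variable.
  have hQ : DefRel fun w : α ⊕ Fin 1 → M =>
      ∀ y, y < w (Sum.inr 0) → ¬ P (fun a => w (Sum.inl a)) y := by
    refine DefRel.all (DefRel.imp (DefRel.lt (.var _) (.var _)) (DefRel.not ?_))
    exact h.subst (g := fun b v => v (Sum.elim (fun a => Sum.inl (Sum.inl a)) Sum.inr b))
      fun b => DefTerm.var _
  have := DefRel.induction (P := fun v x => ∀ y, y < x → ¬ P v y) hQ v
    (fun y hy => absurd hy (not_lt.2 (ArithModel.zero_le' y)))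
    (fun x hx y hy hP => by
      obtain ⟨z, hz, hz'⟩ := hc y hP
      exact hx z (hz.trans_le (lt_succ_iff_le.1 hy)) hz') (x + 1) x (lt_add_one x)
  exact this hx

end Induction

section Coding

variable {M : Type u} [CommSemiring M] [LinearOrder M] [arith.Structure M] [ArithModel M]

/-! ### Standard elements -/

theorem exists_natCast_of_le {x : M} {n : ℕ} (h : x ≤ n) : ∃ m : ℕ, m ≤ n ∧ x = m := by
  induction n with
  | zero => exact ⟨0, le_rfl, le_antisymm (by simpa using h) (by simpa using ArithModel.zero_le' x)⟩
  | succ n ih =>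
    rcases h.lt_or_eq with h | h
    · obtain ⟨m, hm, e⟩ := ih (lt_succ_iff_le.1 (by simpa using h))
      exact ⟨m, hm.trans n.le_succ, e⟩
    · exact ⟨n + 1, le_rfl, h⟩

theorem exists_one_add {x : M} (h : x ≠ 0) : ∃ y, x = 1 + y := by
  have h1 := ArithModel.one_le' x ((ArithModel.zero_le' x).lt_of_ne' h)
  rcases h1.eq_or_lt with rfl | h1
  · exact ⟨0, by simp⟩
  · obtain ⟨y, hy⟩ := ArithModel.exists_add' _ _ h1
    exact ⟨y, hy.symm⟩

theorem mul_ne_zero' {x y : M} (hx : x ≠ 0) (hy : y ≠ 0) : x * y ≠ 0 :=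
  (mul_pos ((ArithModel.zero_le' x).lt_of_ne' hx) ((ArithModel.zero_le' y).lt_of_ne' hy)).ne'

theorem le_add_left' (x y : M) : x ≤ y + x := by
  simpa using add_le_add_left (ArithModel.zero_le' y) x

/-! ### The pairing function `(x + y)² + x` -/

/-- An injective pairing function. -/
def pair (x y : M) : M := (x + y) * (x + y) + x

/-- As `x ≤ x + y`, the code lies strictly below the next square `(x + y + 1)²`. -/
theorem pair_lt_of_add_lt {x y x' y' : M} (h : x + y < x' + y') : pair x y < pair x' y' := by
  have h1 : x + y + 1 ≤ x' + y' := by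
    by_contra! hc
    exact absurd h (not_lt.2 (lt_succ_iff_le.1 hc))
  have hx := ArithModel.zero_le' x
  have hy := ArithModel.zero_le' y
  have hx' := ArithModel.zero_le' x'
  have hy' := ArithModel.zero_le' y'
  have h2 : (x + y + 1) * (x + y + 1) ≤ (x' + y') * (x' + y') :=
    mul_le_mul h1 h1 (by positivity) (by positivity)
  have h3 : (x + y) * (x + y) + x < (x + y + 1) * (x + y + 1) := by
    have : (x + y + 1) * (x + y + 1) = (x + y) * (x + y) + x + (x + 2 * y + 1) := by ring
    rw [this]
    exact lt_add_of_pos_right _ (by positivity)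
  exact (h3.trans_le h2).trans_le (le_add_of_nonneg_right hx')

theorem pair_inj {x y x' y' : M} (h : pair x y = pair x' y') : x = x' ∧ y = y' := by
  rcases lt_trichotomy (x + y) (x' + y') with h1 | h1 | h1
  · exact absurd h (pair_lt_of_add_lt h1).ne
  · have hx : x = x' := by
      unfold pair at h
      rw [h1] at h
      exact add_left_cancel h
    subst hx
    exact ⟨rfl, add_left_cancel h1⟩
  · exact absurd h (pair_lt_of_add_lt h1).ne'

/-- The relation `x` is the first component of the pair `z` (or `0` if `z` is not a pair). -/
def IsFst (z x : M) : Prop := (∃ y, z = pair x y) ∨ (¬ ∃ x y, z = pair x y) ∧ x = 0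

/-- The relation `y` is the second component of the pair `z` (or `0` if `z` is not a pair). -/
def IsSnd (z y : M) : Prop := (∃ x, z = pair x y) ∨ (¬ ∃ x y, z = pair x y) ∧ y = 0

theorem existsUnique_isFst (z : M) : ∃! x, IsFst z x := by
  by_cases h : ∃ x y, z = pair x y
  · obtain ⟨x, y, rfl⟩ := h
    refine ⟨x, Or.inl ⟨y, rfl⟩, ?_⟩
    rintro x' (⟨y', h'⟩ | ⟨h', -⟩)
    · exact (pair_inj h').1.symm
    · exact absurd ⟨x, y, rfl⟩ h'
  · refine ⟨0, Or.inr ⟨h, rfl⟩, ?_⟩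
    rintro x' (⟨y', h'⟩ | ⟨-, h'⟩)
    · exact absurd ⟨x', y', h'⟩ h
    · exact h'

theorem existsUnique_isSnd (z : M) : ∃! y, IsSnd z y := by
  by_cases h : ∃ x y, z = pair x y
  · obtain ⟨x, y, rfl⟩ := h
    refine ⟨y, Or.inl ⟨x, rfl⟩, ?_⟩
    rintro y' (⟨x', h'⟩ | ⟨h', -⟩)
    · exact (pair_inj h').2.symm
    · exact absurd ⟨x, y, rfl⟩ h'
  · refine ⟨0, Or.inr ⟨h, rfl⟩, ?_⟩
    rintro y' (⟨x', h'⟩ | ⟨-, h'⟩)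
    · exact absurd ⟨x', y', h'⟩ h
    · exact h'

/-- The first component of a pair. -/
noncomputable def fst (z : M) : M := (existsUnique_isFst z).choose

/-- The second component of a pair. -/
noncomputable def snd (z : M) : M := (existsUnique_isSnd z).choose

theorem isFst_iff {z x : M} : IsFst z x ↔ x = fst z :=
  ⟨fun h => (existsUnique_isFst z).choose_spec.2 x h,
    fun h => h ▸ (existsUnique_isFst z).choose_spec.1⟩

theorem isSnd_iff {z y : M} : IsSnd z y ↔ y = snd z :=
  ⟨fun h => (existsUnique_isSnd z).choose_spec.2 y h,
    fun h => h ▸ (existsUnique_isSnd z).choose_spec.1⟩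

theorem fst_pair (x y : M) : fst (pair x y) = x := (isFst_iff.1 (Or.inl ⟨y, rfl⟩)).symm

theorem snd_pair (x y : M) : snd (pair x y) = y := (isSnd_iff.1 (Or.inl ⟨x, rfl⟩)).symm

theorem DefTerm.pair {α : Type} {f g : (α → M) → M} (hf : DefTerm f) (hg : DefTerm g) :
    DefTerm fun v => pair (f v) (g v) :=
  ((hf.add hg).mul (hf.add hg)).add hf

theorem defRel_isFst : DefRel fun v : Fin 2 → M => IsFst (v 0) (v 1) :=
  .or (.ex (.eq (.var _) (.pair (.var _) (.var _))))
    (.and (.not (.ex (.ex (.eq (.var _) (.pair (.var _) (.var _)))))) (.eq (.var _) .zero))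

theorem defRel_isSnd : DefRel fun v : Fin 2 → M => IsSnd (v 0) (v 1) :=
  .or (.ex (.eq (.var _) (.pair (.var _) (.var _))))
    (.and (.not (.ex (.ex (.eq (.var _) (.pair (.var _) (.var _)))))) (.eq (.var _) .zero))

/-! ### Gödel's beta function -/

/-- `v` is the `i`-th entry of the sequence coded by `a` and `b`. -/
def Entry (a b i v : M) : Prop :=
  v < 1 + (i + 1) * b ∧ ∃ q, a = v + q * (1 + (i + 1) * b)

theorem defRel_entry : DefRel fun v : Fin 4 → M => Entry (v 0) (v 1) (v 2) (v 3) :=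
  .and (.lt (.var _) (.add .one (.mul (.add (.var _) .one) (.var _))))
    (.ex (.eq (.var _) (.add (.var _)
      (.mul (.var _) (.add .one (.mul (.add (.var _) .one) (.var _)))))))

theorem Entry.unique {a b i v v' : M} (h : Entry a b i v) (h' : Entry a b i v') : v = v' := by
  obtain ⟨hv, q, hq⟩ := h
  obtain ⟨hv', q', hq'⟩ := h'
  set m := 1 + (i + 1) * b
  have aux : ∀ {v v' q q' : M}, v < m → v + q * m = v' + q' * m → ¬ q < q' := by
    intro v v' q q' hv e hlt
    obtain ⟨z, rfl⟩ := ArithModel.exists_add' _ _ hlt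
    have hz : z ≠ 0 := by
      rintro rfl
      simp at hlt
    obtain ⟨z, rfl⟩ := exists_one_add hz
    have e' : v = (v' + z * m) + m := by
      refine add_right_cancel (b := q * m) (e.trans ?_)
      ring
    exact absurd hv (not_lt.2 (e' ▸ le_add_left' _ _))
  have e := hq.symm.trans hq'
  have hqq : q = q' := le_antisymm (not_lt.1 (aux hv' e.symm)) (not_lt.1 (aux hv e))
  rw [hqq] at e
  exact add_right_cancel e

/-- `y` is invertible modulo `x`. -/
def InvMod (x y : M) : Prop := ∃ g q, y * g = 1 + q * x

/-- From `y * g = 1 + q * x` one has `q * x ≡ -1` modulo `y`. Without subtraction, `y' = y - 1`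
plays the role of `-1`, so `q * y'` inverts `x`. -/
theorem InvMod.symm {x y : M} (h : InvMod x y) (hy : 1 < y) : InvMod y x := by
  obtain ⟨g, q, e⟩ := h
  obtain ⟨y', rfl⟩ := ArithModel.exists_add' _ _ hy
  have hy' : y' ≠ 0 := by rintro rfl; simp at hy
  have hg : g ≠ 0 := by
    rintro rfl
    rw [mul_zero] at e
    have : (0 : M) < 1 + q * x :=
      add_pos_of_pos_of_nonneg one_pos (ArithModel.zero_le' _)
    exact this.ne e
  obtain ⟨r, hr⟩ := exists_one_add (mul_ne_zero' hg hy')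
  refine ⟨q * y', r, add_right_cancel (b := y') ?_⟩
  calc x * (q * y') + y' = (1 + q * x) * y' := by ring
    _ = (1 + y') * (g * y') := by rw [← e]; ring
    _ = 1 + r * (1 + y') + y' := by rw [hr]; ring

theorem invMod_of_lt {i j K : ℕ} (hij : i < j) (hj : j < K) {c : M} (hc : c ≠ 0) :
    InvMod (1 + ((i : M) + 1) * ((K.factorial : M) * c))
      (1 + ((j : M) + 1) * ((K.factorial : M) * c)) := by
  obtain ⟨d, rfl⟩ := Nat.exists_eq_add_of_lt hij
  obtain ⟨f, hf⟩ := Nat.dvd_factorial (m := d + 1) (n := K) (by omega) (by omega)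
  have hf0 : (f : M) ≠ 0 := by
    intro h0
    rw [Nat.cast_eq_zero] at h0
    rw [h0, mul_zero] at hf
    exact K.factorial_ne_zero hf
  obtain ⟨r, hr⟩ := exists_one_add (x := ((i : M) + 1) * (((i + d + 1 : ℕ) : M) + 1) * (f * c))
    (mul_ne_zero' (mul_ne_zero' (Nat.cast_add_one_ne_zero i) (Nat.cast_add_one_ne_zero _))
      (mul_ne_zero' hf0 hc))
  -- Write `b = K! * c`. Modulo `1 + (i + 1) * b` the other modulus is `(d + 1) * b`, and `(d + 1) *
  -- f * c = b`, so the product is `((i + 1) * b)² ≡ (-1)² = 1`.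
  refine ⟨((i : M) + 1) * (i + 1) * (f * c), r,
    add_right_cancel (b := ((i : M) + 1) * ((K.factorial : M) * c)) ?_⟩
  have : 1 + r * (1 + ((i : M) + 1) * ((K.factorial : M) * c)) +
      ((i : M) + 1) * ((K.factorial : M) * c) =
      (1 + r) * (1 + ((i : M) + 1) * ((K.factorial : M) * c)) := by ring
  rw [this, ← hr, hf]
  push_cast
  ring

/-- Since the length is standard, the Chinese remainder theorem can be carried out externally, with
finite sums and products in `M`; the sequence need not be definable. -/
theorem exists_entry (K : ℕ) (s : ℕ → M) : ∃ a b : M, ∀ i < K, Entry a b i (s i) := by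
  set c : M := 1 + ∑ i ∈ Finset.range K, s i with hc
  have hsum : (0 : M) ≤ ∑ i ∈ Finset.range K, s i := ArithModel.zero_le' _
  have hcpos : (0 : M) < c := add_pos_of_pos_of_nonneg one_pos hsum
  set b : M := (K.factorial : M) * c with hb
  have hK : (1 : M) ≤ K.factorial := by exact_mod_cast K.factorial_pos
  have hcb : c ≤ b := le_mul_of_one_le_left hcpos.le hK
  have hbpos : 0 < b := hcpos.trans_le hcb
  set m : ℕ → M := fun i => 1 + ((i : M) + 1) * b with hm
  have hbm : ∀ i, b ≤ m i := fun i => by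
    have : m i = (1 + i * b) + b := by simp only [hm]; ring
    rw [this]
    exact le_add_left' _ _
  have hm1 : ∀ i, 1 < m i := fun i =>
    lt_add_of_pos_right _ (mul_pos (Nat.cast_add_one_pos i) hbpos)
  have hlt : ∀ i < K, s i < m i := fun i hi => by
    have h1 : s i ≤ ∑ i ∈ Finset.range K, s i :=
      Finset.single_le_sum (fun j _ => ArithModel.zero_le' _) (Finset.mem_range.2 hi)
    have h2 : s i < c := lt_of_le_of_lt h1 (lt_add_of_pos_left _ one_pos)
    exact h2.trans_le (hcb.trans (hbm i))
  have hinv : ∀ i < K, ∀ j < K, i ≠ j → InvMod (m i) (m j) := by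
    intro i hi j hj hij
    rcases hij.lt_or_gt with h | h
    · exact invMod_of_lt h hj hcpos.ne'
    · exact (invMod_of_lt h hi hcpos.ne').symm (hm1 i)
  -- The coefficient `e` is `1` modulo `m i` and `0` modulo each `m j` with `j ∈ S`; it is the
  -- product of the factors `m j * g`, with `g` inverse to `m j` modulo `m i`.
  have he : ∀ i < K, ∀ S ⊆ Finset.range K, i ∉ S →
      ∃ e q, e = 1 + q * m i ∧ ∀ j ∈ S, m j ∣ e := by
    intro i hi S
    induction S using Finset.induction_on with
    | empty => exact fun _ _ => ⟨1, 0, by simp, by simp⟩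
    | insert j S _ ih =>
      intro hS hiS
      rw [Finset.insert_subset_iff] at hS
      rw [Finset.mem_insert, not_or] at hiS
      obtain ⟨e, q, h1, h2⟩ := ih hS.2 hiS.2
      obtain ⟨g, q', h3⟩ := hinv i hi j (Finset.mem_range.1 hS.1) hiS.1
      refine ⟨e * (m j * g), q + q' + q * q' * m i, ?_, ?_⟩
      · rw [h3, h1]; ring
      · intro k hk
        rcases Finset.mem_insert.1 hk with rfl | hk
        · exact dvd_mul_of_dvd_right (dvd_mul_right _ _) _
        · exact dvd_mul_of_dvd_left (h2 k hk) _
  have he' : ∀ i, ∃ e q, i < K → e = 1 + q * m i ∧ ∀ j < K, j ≠ i → m j ∣ e := by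
    intro i
    by_cases hi : i < K
    · obtain ⟨e, q, h1, h2⟩ := he i hi ((Finset.range K).erase i) (Finset.erase_subset _ _)
        (Finset.notMem_erase _ _)
      exact ⟨e, q, fun _ => ⟨h1, fun j hj hji =>
        h2 j (Finset.mem_erase.2 ⟨hji, Finset.mem_range.2 hj⟩)⟩⟩
    · exact ⟨0, 0, fun h => absurd h hi⟩
  choose e q heq using he'
  refine ⟨∑ i ∈ Finset.range K, s i * e i, b, fun i hi => ⟨hlt i hi, ?_⟩⟩
  have hd : m i ∣ ∑ j ∈ (Finset.range K).erase i, s j * e j := by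
    refine Finset.dvd_sum fun j hj => ?_
    rw [Finset.mem_erase, Finset.mem_range] at hj
    exact dvd_mul_of_dvd_right ((heq j hj.2).2 i hi hj.1.symm) _
  obtain ⟨r, hr⟩ := hd
  refine ⟨s i * q i + r, ?_⟩
  rw [← Finset.add_sum_erase _ _ (Finset.mem_range.2 hi), hr, (heq i hi).1]
  change _ = s i + (s i * q i + r) * m i
  ring

end Coding

section Programs

variable {M : Type u} [CommSemiring M] [LinearOrder M] [arith.Structure M] [ArithModel M]

/-! ### A universal sequence of terms with pairing -/

/-- The relation `p = Nat.pair i j`. -/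
def IsNatPair (i j p : M) : Prop :=
  (i < j ∧ p = j * j + i) ∨ (¬ i < j ∧ p = i * i + i + j)

theorem isNatPair_natCast (i j : ℕ) (p : M) :
    IsNatPair (i : M) j p ↔ p = (Nat.pair i j : ℕ) := by
  unfold IsNatPair Nat.pair
  rw [Nat.cast_lt]
  split_ifs with h <;> simp [h]

theorem le_mul_self (x : M) : x ≤ x * x := by
  rcases eq_or_ne x 0 with rfl | hx
  · simp
  · exact le_mul_of_one_le_right (ArithModel.zero_le' x)
      (ArithModel.one_le' x ((ArithModel.zero_le' x).lt_of_ne' hx))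

theorem IsNatPair.le {i j p : M} (h : IsNatPair i j p) : i ≤ p ∧ j ≤ p := by
  have hi := ArithModel.zero_le' i
  have hj := ArithModel.zero_le' j
  rcases h with ⟨h, rfl⟩ | ⟨h, rfl⟩
  · exact ⟨le_add_left' _ _, (le_mul_self j).trans (le_add_of_nonneg_right hi)⟩
  · exact ⟨(le_add_left' _ _).trans (le_add_of_nonneg_right hj), le_add_left' _ _⟩

/-- The value at `x` of the `m`-th term built from `x`, `0`, `1`, `+`, `·`, `fst`, `snd`. -/
noncomputable def value (x : M) : ℕ → M
  | 0 => x
  | m + 1 =>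
    have h : (m + 1) / 7 < m + 1 := Nat.div_lt_self m.succ_pos (by norm_num)
    have h₁ : ((m + 1) / 7).unpair.1 < m + 1 := (Nat.unpair_left_le _).trans_lt h
    have h₂ : ((m + 1) / 7).unpair.2 < m + 1 := (Nat.unpair_right_le _).trans_lt h
    -- The residue modulo 7 selects the operation; the quotient encodes the indices of its
    -- arguments.
    match (m + 1) % 7 with
    | 0 => x
    | 1 => 0
    | 2 => 1
    | 3 => value x ((m + 1) / 7).unpair.1 + value x ((m + 1) / 7).unpair.2
    | 4 => value x ((m + 1) / 7).unpair.1 * value x ((m + 1) / 7).unpair.2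
    | 5 => fst (value x ((m + 1) / 7).unpair.1)
    | _ => snd (value x ((m + 1) / 7).unpair.1)

theorem value_zero (x : M) (p : ℕ) : value x (7 * p) = x := by
  rcases h : 7 * p with _ | m
  · rw [value]
  · rw [value, ← h, Nat.mul_mod_right]
    rfl

theorem value_succ (x : M) (p : ℕ) :
    value x (7 * p + 1) = 0 ∧ value x (7 * p + 2) = 1 ∧
    value x (7 * p + 3) = value x p.unpair.1 + value x p.unpair.2 ∧
    value x (7 * p + 4) = value x p.unpair.1 * value x p.unpair.2 ∧
    value x (7 * p + 5) = fst (value x p.unpair.1) ∧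
    value x (7 * p + 6) = snd (value x p.unpair.1) := by
  have e : ∀ r < 7, (7 * p + r) / 7 = p ∧ (7 * p + r) % 7 = r := fun r hr => by omega
  refine ⟨?_, ?_, ?_, ?_, ?_, ?_⟩
  all_goals
    rw [value]
    simp only [Nat.add_assoc, Nat.reduceAdd, e _ (by norm_num : 1 < 7), e _ (by norm_num : 2 < 7),
      e _ (by norm_num : 3 < 7), e _ (by norm_num : 4 < 7), e _ (by norm_num : 5 < 7),
      e _ (by norm_num : 6 < 7)]

/-- `a`, `b` code a sequence which satisfies the recursion for `value x` up to `7 * k + 6`. -/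
def IsValueSeq (k a b x : M) : Prop :=
  ∀ i j p, IsNatPair i j p → p ≤ k →
    Entry a b ((7 : ℕ) * p) x ∧ Entry a b ((7 : ℕ) * p + (1 : ℕ)) 0 ∧
    Entry a b ((7 : ℕ) * p + (2 : ℕ)) 1 ∧
    ∀ u, Entry a b i u →
      (∀ w, Entry a b j w → Entry a b ((7 : ℕ) * p + (3 : ℕ)) (u + w) ∧
        Entry a b ((7 : ℕ) * p + (4 : ℕ)) (u * w)) ∧
      (∀ w, IsFst u w → Entry a b ((7 : ℕ) * p + (5 : ℕ)) w) ∧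
      (∀ w, IsSnd u w → Entry a b ((7 : ℕ) * p + (6 : ℕ)) w)

/-- The induction is external, so `k`, `a`, `b` may be nonstandard: any coded solution of the
recursion is correct at the standard indices up to `k`. -/
theorem IsValueSeq.entry {k a b x : M} (h : IsValueSeq k a b x) (m : ℕ) (hm : (m : M) ≤ k) :
    Entry a b (m : M) (value x m) := by
  induction m using Nat.strong_induction_on with
  | _ m ih =>
    obtain ⟨p, r, hr, rfl⟩ : ∃ p r, r < 7 ∧ m = 7 * p + r :=
      ⟨m / 7, m % 7, Nat.mod_lt _ (by norm_num), (Nat.div_add_mod m 7).symm⟩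
    have hpk : (p : M) ≤ k := (Nat.cast_le.2 (by omega)).trans hm
    obtain ⟨h0, h1, h2, h3⟩ := h (p.unpair.1 : ℕ) (p.unpair.2 : ℕ) p
      ((isNatPair_natCast _ _ _).2 (by rw [Nat.pair_unpair])) hpk
    obtain ⟨v1, v2, v3, v4, v5, v6⟩ := value_succ x p
    have hl := Nat.unpair_left_le p
    have hr' := Nat.unpair_right_le p
    have hi : 3 ≤ r → Entry a b ((p.unpair.1 : ℕ) : M) (value x p.unpair.1) := fun h3 =>
      ih _ (by omega) ((Nat.cast_le.2 hl).trans hpk)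
    have hj : 3 ≤ r → Entry a b ((p.unpair.2 : ℕ) : M) (value x p.unpair.2) := fun h3 =>
      ih _ (by omega) ((Nat.cast_le.2 hr').trans hpk)
    rw [Nat.cast_add, Nat.cast_mul]
    interval_cases r
    · rw [Nat.add_zero, value_zero, Nat.cast_zero, add_zero]; exact h0
    · rw [v1]; exact h1
    · rw [v2]; exact h2
    · rw [v3]; exact ((h3 _ (hi le_rfl)).1 _ (hj le_rfl)).1
    · rw [v4]; exact ((h3 _ (hi (by norm_num))).1 _ (hj (by norm_num))).2
    · rw [v5]; exact (h3 _ (hi (by norm_num))).2.1 _ (isFst_iff.2 rfl)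
    · rw [v6]; exact (h3 _ (hi (by norm_num))).2.2 _ (isSnd_iff.2 rfl)

theorem exists_isValueSeq (k : ℕ) (x : M) : ∃ a b : M, IsValueSeq (k : M) a b x := by
  -- The largest index used is `7 * k + 6`. The bounds `i, j ≤ p ≤ k` make all indices standard.
  obtain ⟨a, b, h⟩ := exists_entry (7 * k + 7) (value x)
  refine ⟨a, b, fun i j p hp hpk => ?_⟩
  obtain ⟨p', hp', rfl⟩ := exists_natCast_of_le hpk
  obtain ⟨i', hi', rfl⟩ := exists_natCast_of_le hp.le.1
  obtain ⟨j', hj', rfl⟩ := exists_natCast_of_le hp.le.2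
  rw [isNatPair_natCast, Nat.cast_inj] at hp
  obtain ⟨v1, v2, v3, v4, v5, v6⟩ := value_succ x p'
  have v0 := value_zero x p'
  rw [hp, Nat.unpair_pair, ← hp] at v3 v4 v5 v6
  simp only [← Nat.cast_mul, ← Nat.cast_add]
  refine ⟨v0 ▸ h _ (by omega), v1 ▸ h _ (by omega), v2 ▸ h _ (by omega), fun u hu => ?_⟩
  obtain rfl := hu.unique (h i' (by omega))
  refine ⟨fun w hw => ?_, fun w hw => ?_, fun w hw => ?_⟩
  · obtain rfl := hw.unique (h j' (by omega))
    exact ⟨v3 ▸ h _ (by omega), v4 ▸ h _ (by omega)⟩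
  · obtain rfl := isFst_iff.1 hw
    exact v5 ▸ h _ (by omega)
  · obtain rfl := isSnd_iff.1 hw
    exact v6 ▸ h _ (by omega)

/-- The definable form of `value x i < value x j`. -/
def ValueLt (i j x : M) : Prop :=
  ∃ k a b, IsValueSeq k a b x ∧ i ≤ k ∧ j ≤ k ∧
    ∃ u w, Entry a b i u ∧ Entry a b j w ∧ u < w

theorem valueLt_natCast (i j : ℕ) (x : M) :
    ValueLt (i : M) (j : M) x ↔ value x i < value x j := by
  constructor
  · rintro ⟨k, a, b, h, hi, hj, u, w, hu, hw, huw⟩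
    rwa [hu.unique (h.entry i hi), hw.unique (h.entry j hj)] at huw
  · intro hlt
    obtain ⟨a, b, h⟩ := exists_isValueSeq (max i j) x
    have hi : (i : M) ≤ (max i j : ℕ) := Nat.cast_le.2 (le_max_left _ _)
    have hj : (j : M) ≤ (max i j : ℕ) := Nat.cast_le.2 (le_max_right _ _)
    exact ⟨_, a, b, h, hi, hj, _, _, h.entry i hi, h.entry j hj, hlt⟩

theorem defRel_isNatPair : DefRel fun v : Fin 3 → M => IsNatPair (v 0) (v 1) (v 2) :=
  .or (.and (.lt (.var _) (.var _)) (.eq (.var _) (.add (.mul (.var _) (.var _)) (.var _))))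
    (.and (.not (.lt (.var _) (.var _)))
      (.eq (.var _) (.add (.add (.mul (.var _) (.var _)) (.var _)) (.var _))))

theorem defRel_isValueSeq :
    DefRel fun v : Fin 4 → M => IsValueSeq (v 0) (v 1) (v 2) (v 3) := by
  have hE : ∀ {α : Type} {f g i e : (α → M) → M}, DefTerm f → DefTerm g → DefTerm i →
      DefTerm e → DefRel fun v => Entry (f v) (g v) (i v) (e v) :=
    fun h₀ h₁ h₂ h₃ => DefRel.comp₄ defRel_entry h₀ h₁ h₂ h₃
  have hI : ∀ {α : Type} {p : (α → M) → M} (r : ℕ), DefTerm p →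
      DefTerm fun v => ((7 : ℕ) : M) * p v + (r : M) :=
    fun r hp => ((DefTerm.natCast 7).mul hp).add (.natCast r)
  refine .all (.all (.all (.imp (.comp₃ defRel_isNatPair (.var _) (.var _) (.var _))
    (.imp (.le (.var _) (.var _)) (.and ?_ (.and ?_ (.and ?_ (.all (.imp ?_ (.and ?_
      (.and ?_ ?_)))))))))))
  · exact hE (.var _) (.var _) ((DefTerm.natCast 7).mul (.var _)) (.var _)
  · exact hE (.var _) (.var _) (hI 1 (.var _)) .zero
  · exact hE (.var _) (.var _) (hI 2 (.var _)) .one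
  · exact hE (.var _) (.var _) (.var _) (.var _)
  · exact .all (.imp (hE (.var _) (.var _) (.var _) (.var _))
      (.and (hE (.var _) (.var _) (hI 3 (.var _)) (.add (.var _) (.var _)))
        (hE (.var _) (.var _) (hI 4 (.var _)) (.mul (.var _) (.var _)))))
  · exact .all (.imp (.comp₂ defRel_isFst (.var _) (.var _))
      (hE (.var _) (.var _) (hI 5 (.var _)) (.var _)))
  · exact .all (.imp (.comp₂ defRel_isSnd (.var _) (.var _))
      (hE (.var _) (.var _) (hI 6 (.var _)) (.var _)))

theorem defRel_valueLt : DefRel fun v : Fin 3 → M => ValueLt (v 0) (v 1) (v 2) :=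
  .ex (.ex (.ex (.and (.comp₄ defRel_isValueSeq (.var _) (.var _) (.var _) (.var _))
    (.and (.le (.var _) (.var _)) (.and (.le (.var _) (.var _))
      (.ex (.ex (.and (.comp₄ defRel_entry (.var _) (.var _) (.var _) (.var _))
        (.and (.comp₄ defRel_entry (.var _) (.var _) (.var _) (.var _))
          (.lt (.var _) (.var _)))))))))))

/-! ### Functions given by terms with pairing -/

/-- The functions built from `0`, `1`, `+`, `·` and the projections of the pairing function. -/
inductive IsProg : (M → M) → Prop
  | id : IsProg fun x => x
  | zero : IsProg fun _ => 0
  | one : IsProg fun _ => 1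
  | add {f g : M → M} : IsProg f → IsProg g → IsProg fun x => f x + g x
  | mul {f g : M → M} : IsProg f → IsProg g → IsProg fun x => f x * g x
  | fst {f : M → M} : IsProg f → IsProg fun x => fst (f x)
  | snd {f : M → M} : IsProg f → IsProg fun x => snd (f x)

theorem IsProg.comp {f g : M → M} (hf : IsProg f) (hg : IsProg g) : IsProg fun x => f (g x) := by
  induction hf with
  | id => exact hg
  | zero => exact .zero
  | one => exact .one
  | add _ _ h h' => exact .add h h'
  | mul _ _ h h' => exact .mul h h'
  | fst _ h => exact .fst h
  | snd _ h => exact .snd h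

theorem IsProg.exists_value {f : M → M} (hf : IsProg f) : ∃ m, ∀ x, value x m = f x := by
  induction hf with
  | id => exact ⟨7 * 0, fun x => value_zero x 0⟩
  | zero => exact ⟨7 * 0 + 1, fun x => (value_succ x 0).1⟩
  | one => exact ⟨7 * 0 + 2, fun x => (value_succ x 0).2.1⟩
  | add _ _ h h' =>
    obtain ⟨i, hi⟩ := h
    obtain ⟨j, hj⟩ := h'
    refine ⟨7 * Nat.pair i j + 3, fun x => ?_⟩
    rw [(value_succ x _).2.2.1, Nat.unpair_pair, hi, hj]
  | mul _ _ h h' =>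
    obtain ⟨i, hi⟩ := h
    obtain ⟨j, hj⟩ := h'
    refine ⟨7 * Nat.pair i j + 4, fun x => ?_⟩
    rw [(value_succ x _).2.2.2.1, Nat.unpair_pair, hi, hj]
  | fst _ h =>
    obtain ⟨i, hi⟩ := h
    refine ⟨7 * Nat.pair i 0 + 5, fun x => ?_⟩
    rw [(value_succ x _).2.2.2.2.1, Nat.unpair_pair, hi]
  | snd _ h =>
    obtain ⟨i, hi⟩ := h
    refine ⟨7 * Nat.pair i 0 + 6, fun x => ?_⟩
    rw [(value_succ x _).2.2.2.2.2, Nat.unpair_pair, hi]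

/-- Tuples are coded as nested pairs, so iterated projections decode them. -/
theorem exists_isProg_tuple (k : ℕ) :
    ∃ g : Fin k → M → M, (∀ j, IsProg (g j)) ∧ ∀ y : Fin k → M, ∃ u, ∀ j, g j u = y j := by
  induction k with
  | zero => exact ⟨Fin.elim0, fun j => j.elim0, fun _ => ⟨0, fun j => j.elim0⟩⟩
  | succ k ih =>
    obtain ⟨g, hg, h⟩ := ih
    refine ⟨Fin.cons (fun x => fst x) fun j x => g j (snd x), fun j => ?_, fun y => ?_⟩
    · refine Fin.cases ?_ (fun j => ?_) j
      · exact .fst .id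
      · exact (hg j).comp (.snd .id)
    · obtain ⟨u, hu⟩ := h (Fin.tail y)
      refine ⟨pair (y 0) u, fun j => ?_⟩
      refine Fin.cases ?_ (fun j => ?_) j
      · exact fst_pair _ _
      · exact (congrArg (g j) (snd_pair _ _)).trans (hu j)

theorem IsProg.term {n : ℕ} {f : Fin n → M → M} (hf : ∀ i, IsProg (f i)) (xs : Fin 0 → M)
    (t : arith.Term (Fin n ⊕ Fin 0)) :
    IsProg fun s => t.realize (Sum.elim (fun i => f i s) xs) := by
  induction t with
  | var a =>
    rcases a with a | a
    · exact hf a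
    · exact a.elim0
  | func F ts ih =>
    cases F with
    | zero => simpa only [Term.realize_func, ArithModel.funMap_zero] using IsProg.zero
    | one => simpa only [Term.realize_func, ArithModel.funMap_one] using IsProg.one
    | add => simpa only [Term.realize_func, ArithModel.funMap_add] using (ih 0).add (ih 1)
    | mul => simpa only [Term.realize_func, ArithModel.funMap_mul] using (ih 0).mul (ih 1)

end Programs

section BackAndForth

variable {M : Type u} [CommSemiring M] [LinearOrder M] [arith.Structure M] [ArithModel M]

/-! ### Definable back-and-forth relations -/

/-- The `n`-th back-and-forth relation between elements, regarded as codes of tuples, which starts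
from the agreement on the relations `ValueLt i j` for all `i, j < c`. -/
def BackForth : ℕ → M → M → M → Prop
  | 0, c, x, y => ∀ i, i < c → ∀ j, j < c → (ValueLt i j x ↔ ValueLt i j y)
  | n + 1, c, x, y => (∀ u, ∃ w, BackForth n c (pair x u) (pair y w)) ∧
      ∀ w, ∃ u, BackForth n c (pair x u) (pair y w)

/-- Here `n` is external, giving one formula for each `n`, while `c` is a variable; this is what
permits overspill in `c`. -/
theorem defRel_backForth (n : ℕ) :
    DefRel fun v : Fin 3 → M => BackForth n (v 0) (v 1) (v 2) := by
  induction n with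
  | zero =>
    exact .all (.imp (.lt (.var _) (.var _)) (.all (.imp (.lt (.var _) (.var _))
      (.iff (.comp₃ defRel_valueLt (.var _) (.var _) (.var _))
        (.comp₃ defRel_valueLt (.var _) (.var _) (.var _))))))
  | succ n ih =>
    exact .and
      (.all (.ex (.comp₃ ih (.var _) (.pair (.var _) (.var _)) (.pair (.var _) (.var _)))))
      (.all (.ex (.comp₃ ih (.var _) (.pair (.var _) (.var _)) (.pair (.var _) (.var _)))))

set_option linter.unusedSectionVars false in
theorem BackForth.symm {n : ℕ} {c x y : M} (h : BackForth n c x y) : BackForth n c y x := by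
  induction n generalizing x y with
  | zero => exact fun i hi j hj => (h i hi j hj).symm
  | succ n ih =>
    exact ⟨fun u => (h.2 u).imp fun _ => ih, fun u => (h.1 u).imp fun _ => ih⟩

/-- At level 0 the type of `x` records which of the `k * k` comparisons hold; at the next level it
is the set of types of the extensions of `x`. -/
theorem exists_finite_classification (n k : ℕ) :
    ∃ (τ : Type) (_ : Finite τ) (f : M → τ), ∀ x y, f x = f y → BackForth n (k : M) x y := by
  induction n with
  | zero =>
    refine ⟨Set (Fin k × Fin k), inferInstance,
      fun x => {p | ValueLt ((p.1 : ℕ) : M) ((p.2 : ℕ) : M) x}, fun x y h i hi j hj => ?_⟩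
    obtain ⟨i, -, rfl⟩ := exists_natCast_of_le hi.le
    obtain ⟨j, -, rfl⟩ := exists_natCast_of_le hj.le
    exact Set.ext_iff.1 h (⟨i, Nat.cast_lt.1 hi⟩, ⟨j, Nat.cast_lt.1 hj⟩)
  | succ n ih =>
    obtain ⟨τ, _, f, hf⟩ := ih
    refine ⟨Set τ, inferInstance, fun x => Set.range fun u => f (pair x u), fun x y h => ?_⟩
    beta_reduce at h
    constructor
    · intro u
      obtain ⟨w, hw⟩ : f (pair x u) ∈ Set.range fun u => f (pair y u) := h ▸ ⟨u, rfl⟩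
      exact ⟨w, hf _ _ hw.symm⟩
    · intro w
      obtain ⟨u, hu⟩ : f (pair y w) ∈ Set.range fun u => f (pair x u) := h ▸ ⟨w, rfl⟩
      exact ⟨u, hf _ _ hu⟩

theorem exists_ne_backForth (n k : ℕ) : ∃ x y : M, x ≠ y ∧ BackForth n (k : M) x y := by
  obtain ⟨τ, _, f, hf⟩ := exists_finite_classification (M := M) n k
  have : Infinite M := Infinite.of_injective (Nat.cast : ℕ → M) Nat.cast_injective
  obtain ⟨x, y, hne, h⟩ := Finite.exists_ne_map_eq_of_infinite f
  exact ⟨x, y, hne, hf x y h⟩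

theorem BackForth.lt_iff_lt {c : M} (hc : ∀ k : ℕ, (k : M) < c) {n : ℕ} {s t : M}
    (h : BackForth n c s t) {f g : M → M} (hf : IsProg f) (hg : IsProg g) : f s < g s ↔ f t < g t := by
  induction n generalizing s t f g with
  | zero =>
    obtain ⟨i, hi⟩ := hf.exists_value
    obtain ⟨j, hj⟩ := hg.exists_value
    rw [← hi, ← hj, ← hi, ← hj, ← valueLt_natCast, ← valueLt_natCast]
    exact h i (hc i) j (hc j)
  | succ n ih =>
    -- A round is discarded by extending `s` with a dummy `0` and reading the first component.
    obtain ⟨w, hw⟩ := h.1 0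
    simpa only [fst_pair] using ih hw (hf.comp (.fst .id)) (hg.comp (.fst .id))

theorem BackForth.realize_qf_iff {c : M} (hc : ∀ k : ℕ, (k : M) < c) {n p : ℕ} {s t : M}
    (h : BackForth n c s t) {f : Fin p → M → M} (hf : ∀ i, IsProg (f i)) {φ : arith.Formula (Fin p)}
    (hφ : BoundedFormula.IsQF φ) :
    φ.Realize (fun i => f i s) ↔ φ.Realize fun i => f i t := by
  unfold Formula.Realize
  induction hφ with
  | falsum => exact Iff.rfl
  | of_isAtomic h' =>
    cases h' with
    | equal t₁ t₂ =>
      have h₁ := IsProg.term hf default t₁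
      have h₂ := IsProg.term hf default t₂
      have l₁ := h.lt_iff_lt hc h₁ h₂
      have l₂ := h.lt_iff_lt hc h₂ h₁
      rw [BoundedFormula.realize_bdEqual, BoundedFormula.realize_bdEqual]
      constructor
      · intro e
        exact le_antisymm (not_lt.1 fun hl => (l₂.2 hl).ne' e) (not_lt.1 fun hl => (l₁.2 hl).ne e)
      · intro e
        exact le_antisymm (not_lt.1 fun hl => (l₂.1 hl).ne' e) (not_lt.1 fun hl => (l₁.1 hl).ne e)
    | rel R ts =>
      cases R with
      | lt =>
        rw [BoundedFormula.realize_rel, BoundedFormula.realize_rel, ArithModel.relMap_lt,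
          ArithModel.relMap_lt]
        exact h.lt_iff_lt hc (IsProg.term hf default (ts 0)) (IsProg.term hf default (ts 1))
  | imp _ _ ih₁ ih₂ =>
    rw [BoundedFormula.realize_imp, BoundedFormula.realize_imp, ih₁, ih₂]

/-- The usual back-and-forth induction, for Σ and Π together since they alternate: a Σ step uses the
forth half and a Π step the back half. Tuples enter as programs evaluated at one code. -/
theorem BackForth.realize_infFormula {c : M} (hc : ∀ k : ℕ, (k : M) < c) {p : ℕ}
    (φ : InfFormula arith p) {α : Ordinal.{0}} (hφ : φ.IsSigma α ∨ φ.IsPi α) {n : ℕ} (hα : α ≤ n) {s t : M} (h : BackForth n c s t)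
    {f : Fin p → M → M} (hf : ∀ i, IsProg (f i)) (hs : φ.Realize fun i => f i s) :
    φ.Realize fun i => f i t := by
  -- The extended tuple is coded by `pair s u`: old entries are read through `fst`, new ones through
  -- `snd`.
  have append_eq : ∀ {p k : ℕ} (f : Fin p → M → M) (g : Fin k → M → M) (s u : M)
      (y : Fin k → M), (∀ j, g j u = y j) →
      (fun i => Fin.append (fun i x => f i (fst x)) (fun j x => g j (snd x)) i (pair s u)) =
        Fin.append (fun i => f i s) y := by
    intro p k f g s u y hu
    ext i
    refine Fin.addCases (fun i => ?_) (fun j => ?_) i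
    · rw [Fin.append_left, Fin.append_left, fst_pair]
    · rw [Fin.append_right, Fin.append_right, snd_pair, hu]
  have append_prog : ∀ {p k : ℕ} {f : Fin p → M → M} {g : Fin k → M → M},
      (∀ i, IsProg (f i)) → (∀ j, IsProg (g j)) →
      ∀ i, IsProg (Fin.append (fun i x => f i (fst x)) (fun j x => g j (snd x)) i) := by
    intro p k f g hf hg i
    refine Fin.addCases (fun i => ?_) (fun j => ?_) i
    · rw [Fin.append_left]; exact (hf i).comp (.fst .id)
    · rw [Fin.append_right]; exact (hg j).comp (.snd .id)
  have lower : ∀ {β α : Ordinal.{0}} {n : ℕ}, β < α → α ≤ n → ∃ m, n = m + 1 ∧ β ≤ m := by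
    intro β α n h1 h2
    rcases n with _ | m
    · exact absurd (h1.trans_le h2) (by simp)
    · exact ⟨m, rfl, Order.lt_succ_iff.1 (by simpa using h1.trans_le h2)⟩
  induction φ generalizing α n s t with
  | ofFormula φ =>
    refine (h.realize_qf_iff hc hf ?_).1 hs
    rcases hφ with hφ | hφ
    · cases hφ with | quantifierFree h => exact h
    · cases hφ with | quantifierFree h => exact h
  | iSupEx k φ ih =>
    rcases hφ with hφ | hφ
    · cases hφ with
      | iSupEx β hβ hφ =>
        obtain ⟨i, y, hy⟩ := hs
        obtain ⟨g, hg, hcode⟩ := exists_isProg_tuple (M := M) (k i)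
        obtain ⟨u, hu⟩ := hcode y
        obtain ⟨m, rfl, hm⟩ := lower (hβ i) hα
        obtain ⟨w, hw⟩ := h.1 u
        refine ⟨i, fun j => g j w, ?_⟩
        rw [← append_eq f g t w _ fun _ => rfl]
        refine ih i (Or.inr (hφ i)) hm hw (append_prog hf hg) ?_
        rwa [append_eq f g s u y hu]
    · cases hφ
  | iInfAll k φ ih =>
    rcases hφ with hφ | hφ
    · cases hφ
    · cases hφ with
      | iInfAll β hβ hφ =>
        intro i y
        obtain ⟨g, hg, hcode⟩ := exists_isProg_tuple (M := M) (k i)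
        obtain ⟨w, hw⟩ := hcode y
        obtain ⟨m, rfl, hm⟩ := lower (hβ i) hα
        obtain ⟨u, hu⟩ := h.2 w
        rw [← append_eq f g t w y hw]
        refine ih i (Or.inl (hφ i)) hm hu (append_prog hf hg) ?_
        rw [append_eq f g s u _ fun _ => rfl]
        exact hs i _

/-! ### Elements fixed by all automorphisms -/

/-- `x` is fixed by all automorphisms of `M`. -/
def IsFixed (x : M) : Prop := ∀ σ : M ≃[arith] M, σ x = x

theorem equiv_lt_iff (σ : M ≃[arith] M) (x y : M) : σ x < σ y ↔ x < y :=
  DefRel.map_equiv (P := fun v : Fin 2 → M => v 0 < v 1) (.lt (.var _) (.var _)) σ ![x, y]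

/-- Invariance and minimality give `m ≤ σ m` for every `σ`; the same bound for the inverse gives
equality. -/
theorem IsFixed.of_least {P : M → Prop} (hP : ∀ (σ : M ≃[arith] M) x, P (σ x) ↔ P x) {m : M}
    (hm : P m) (hmin : ∀ y < m, ¬ P y) : IsFixed m := by
  have le : ∀ σ : M ≃[arith] M, m ≤ σ m := fun σ =>
    not_lt.1 fun h => hmin _ h ((hP σ m).2 hm)
  intro σ
  refine le_antisymm (not_lt.1 fun h => ?_) (le σ)
  have h' := (equiv_lt_iff σ.symm _ _).2 h
  rw [FirstOrder.Language.Equiv.symm_apply_apply] at h'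
  exact not_lt.2 (le σ.symm) h'

theorem isFixed_natCast (n : ℕ) : IsFixed (n : M) := by
  intro σ
  have := DefRel.map_equiv (M := M) (P := fun v : Fin 1 → M => v 0 = (n : M))
    (.eq (.var _) (.natCast n)) σ ![(n : M)]
  exact this.2 rfl

theorem realize_completeTheory_of_fixed (h : ∀ x : M, IsFixed x → ∃ n : ℕ, x = n) :
    M ⊨ arith.completeTheory ℕ := by
  let e : ℕ ↪[arith] M :=
    { toFun := fun n => (n : M)
      inj' := Nat.cast_injective
      map_fun' := fun {n} F x => by
        cases F with
        | zero => exact Nat.cast_zero.trans (ArithModel.funMap_zero _).symm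
        | one => exact Nat.cast_one.trans (ArithModel.funMap_one _).symm
        | add => exact (Nat.cast_add _ _).trans (ArithModel.funMap_add fun i => (x i : M)).symm
        | mul => exact (Nat.cast_mul _ _).trans (ArithModel.funMap_mul fun i => (x i : M)).symm
      map_rel' := fun {n} R x => by
        cases R with
        | lt => exact (ArithModel.relMap_lt _).trans Nat.cast_lt }
  have elem := e.toElementaryEmbedding ?_
  · have := elem.elementarilyEquivalent
    rw [elementarilyEquivalent_iff] at this
    exact ⟨fun φ hφ => (this φ).1 hφ⟩
  · intro n φ x a ha
    have hdef : DefRel fun w : Fin n ⊕ Fin 1 → M =>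
        φ.Realize default (Fin.snoc (fun i => w (Sum.inl i)) (w (Sum.inr 0)) : Fin (n + 1) → M) := by
      refine ⟨φ.toFormula.relabel (Sum.elim Empty.elim
        (Fin.snoc (fun i => Sum.inl i) (Sum.inr 0) : Fin (n + 1) → Fin n ⊕ Fin 1)), fun w => ?_⟩
      rw [Formula.realize_relabel, BoundedFormula.realize_toFormula]
      refine iff_of_eq (congrArg₂ _ (Subsingleton.elim _ _) (funext fun i => ?_))
      refine Fin.lastCases ?_ (fun i => ?_) i <;> simp
    -- Tarski–Vaught: the parameters are standard, hence fixed, so the least witness is fixed and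
    -- therefore standard.
    obtain ⟨m, hm, hmin⟩ := DefRel.exists_least (P := fun (v : Fin n → M) (x : M) =>
      φ.Realize default (Fin.snoc v x : Fin (n + 1) → M)) hdef (e ∘ x) ha
    have hfix : IsFixed m := by
      refine IsFixed.of_least (P := fun y =>
        φ.Realize default (Fin.snoc (e ∘ x) y : Fin (n + 1) → M)) (fun σ y => ?_) hm hmin
      have := hdef.map_equiv σ (Sum.elim (e ∘ x) fun _ => y)
      simp only [Sum.elim_inl, Sum.elim_inr] at this
      have hx : ∀ i, σ ((e ∘ x) i) = (e ∘ x) i := fun i => isFixed_natCast (x i) σ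
      simp only [hx] at this
      exact this
    obtain ⟨b, rfl⟩ := h m hfix
    exact ⟨b, hm⟩

theorem exists_fixed_ne_backForth (n : ℕ) (hTA : ¬ M ⊨ arith.completeTheory ℕ) :
    ∃ x y : M, x ≠ y ∧ IsFixed x ∧ ∃ c : M, (∀ k : ℕ, (k : M) < c) ∧ BackForth n c x y := by
  have hfix : ∃ d : M, IsFixed d ∧ ∀ k : ℕ, (k : M) < d := by
    by_contra! hc
    refine hTA (realize_completeTheory_of_fixed fun x hx => ?_)
    obtain ⟨k, hk⟩ := hc x hx
    obtain ⟨m, -, hm⟩ := exists_natCast_of_le hk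
    exact ⟨m, hm⟩
  obtain ⟨d, hd, hdk⟩ := hfix
  have hbad : DefRel fun v : Fin 1 → M => ¬ ∃ x y, x ≠ y ∧ BackForth n (v 0) x y :=
    .not (.ex (.ex (.and (.not (.eq (.var _) (.var _)))
      (.comp₃ (defRel_backForth n) (.var _) (.var _) (.var _)))))
  have hc : ∃ c : M, IsFixed c ∧ (∀ k : ℕ, (k : M) < c) ∧
      ∃ x y, x ≠ y ∧ BackForth n c x y := by
    by_cases hgood : ∃ x y, x ≠ y ∧ BackForth n d x y
    · exact ⟨d, hd, hdk, hgood⟩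
    -- Overspill: the least bad bound `b` is fixed, and nonstandard because standard bounds are
    -- good. Its predecessor is then good, fixed and nonstandard.
    · obtain ⟨b, hb, hmin⟩ := DefRel.exists_least (α := Empty)
        (P := fun _ c => ¬ ∃ x y : M, x ≠ y ∧ BackForth n c x y)
        (DefRel.comp₁ (P := fun c : M => ¬ ∃ x y, x ≠ y ∧ BackForth n c x y) hbad
          (.var (Sum.inr 0))) Empty.elim hgood
      have hbfix : IsFixed b := IsFixed.of_least
        (P := fun c => ¬ ∃ x y : M, x ≠ y ∧ BackForth n c x y)
        (fun σ c => hbad.map_equiv σ ![c]) hb hmin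
      have hbk : ∀ k : ℕ, (k : M) < b := by
        intro k
        by_contra! hk
        obtain ⟨m, -, rfl⟩ := exists_natCast_of_le hk
        exact hb (exists_ne_backForth n m)
      obtain ⟨c, rfl⟩ := exists_one_add (x := b) (by
        rintro rfl
        simpa using hbk 0)
      refine ⟨c, fun σ => ?_, fun k => ?_, not_not.1 (hmin c (lt_one_add c))⟩
      · have h₁ := DefRel.map_equiv (M := M) (P := fun v : Fin 2 → M => v 0 = 1 + v 1)
          (.eq (.var _) (.add .one (.var _))) σ ![1 + c, c]
        have h₂ : σ (1 + c) = 1 + σ c := h₁.2 rfl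
        rw [hbfix σ] at h₂
        exact (add_left_cancel h₂).symm
      · have := hbk (k + 1)
        rw [Nat.cast_add, Nat.cast_one, add_comm] at this
        exact lt_of_add_lt_add_left this
  obtain ⟨c, hcfix, hck, hex⟩ := hc
  obtain ⟨x₀, hx₀⟩ := hex
  have hP : DefRel fun v : Fin 2 → M => ∃ y, v 1 ≠ y ∧ BackForth n (v 0) (v 1) y :=
    .ex (.and (.not (.eq (.var _) (.var _)))
      (.comp₃ (defRel_backForth n) (.var _) (.var _) (.var _)))
  -- The only parameter is the fixed `c`, so the least such `x` is fixed as well.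
  obtain ⟨x, hx, hmin⟩ := DefRel.exists_least (α := Fin 1)
    (P := fun v x => ∃ y, x ≠ y ∧ BackForth n (v 0) x y)
    (DefRel.comp₂ (P := fun c x : M => ∃ y, x ≠ y ∧ BackForth n c x y) hP
      (.var (Sum.inl 0)) (.var (Sum.inr 0))) ![c] hx₀
  have hxfix : IsFixed x := by
    refine IsFixed.of_least (P := fun x => ∃ y, x ≠ y ∧ BackForth n c x y) (fun σ x => ?_) hx hmin
    have := hP.map_equiv σ ![c, x]
    simp only [Matrix.cons_val_zero, Matrix.cons_val_one, hcfix σ] at this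
    exact this
  obtain ⟨y, hne, hxy⟩ := hx
  exact ⟨x, y, hne, hxfix, c, hck, hxy⟩

theorem not_orbitsSigmaDefinable_natCast (n : ℕ) (hTA : ¬ M ⊨ arith.completeTheory ℕ) :
    ¬ OrbitsSigmaDefinable arith M n := by
  intro h
  obtain ⟨x, y, hne, hx, c, hc, hxy⟩ := exists_fixed_ne_backForth n hTA
  obtain ⟨φ, hφ, hdef⟩ := h 1 fun _ => x
  have hφx : φ.Realize fun _ => x := (hdef _).2 ⟨FirstOrder.Language.Equiv.refl arith M, fun _ => rfl⟩
  have hφy : φ.Realize fun _ => y := BackForth.realize_infFormula hc φ (Or.inl hφ) le_rfl hxy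
    (f := fun _ x => x) (fun _ => .id) hφx
  obtain ⟨σ, hσ⟩ := (hdef _).1 hφy
  exact hne ((hx σ).symm.trans (hσ 0))

end BackAndForth

end arith

theorem mainTheorem3 {M : Type u} [Countable M] [arith.Structure M]
    (hPA : M ⊨ arith.PA) (hTA : ¬ M ⊨ arith.completeTheory ℕ) :
    ((Ordinal.omega0 : Ordinal.{0}) : WithTop Ordinal.{0}) ≤ scottRank arith M := by
  obtain ⟨_, _, _⟩ := arith.exists_arithModel hPA
  have key : ∀ r ∈ {r | ∃ α : Ordinal.{0}, r = (α : WithTop Ordinal.{0}) ∧ 1 ≤ α ∧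
      OrbitsSigmaDefinable arith M α}, ((Ordinal.omega0 : Ordinal.{0}) : WithTop Ordinal.{0}) ≤ r := by
    rintro _ ⟨α, rfl, -, hα⟩
    rw [WithTop.coe_le_coe]
    by_contra! hlt
    obtain ⟨n, rfl⟩ := Ordinal.lt_omega0.1 hlt
    exact arith.not_orbitsSigmaDefinable_natCast n hTA hα
  unfold scottRank
  -- The infimum of the empty set is `⊤`, so no existence theorem for Scott ranks is needed.
  rcases Set.eq_empty_or_nonempty {r | ∃ α : Ordinal.{0}, r = (α : WithTop Ordinal.{0}) ∧ 1 ≤ α ∧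
      OrbitsSigmaDefinable arith M α} with h | h
  · rw [h, WithTop.sInf_empty]
    exact le_top
  · exact le_csInf h key
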